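/- Let $M$ be a smooth ($C^\infty$, Hausdorff, boundaryless) manifold of dimension $n$, let $U:M\to\mathbb{R}$ be a smooth function with $U\ge 0$, and let $p\in M$ satisfy $U(p)=0$. Suppose that there are an open neighbourhood $A$ of $p$ in $M$ and a vector field $V$ on $A$ with $V(p)\neq 0$ such that 1. $V$ is locally Lipschitz continuous, that is, its coordinate expression in every smooth chart is locally Lipschitz; and 2. $V$ is weakly logarithmic for $U$ on $A$, that is, there is a function $P:A\to\mathbb{R}$, bounded on every compact subset of $A$, with $V(U)=P\,U$ on $A$. Let $Q=(x\mapsto Q_x)$ be any kinetic term on $M$, that is, any smooth section of positive definite quadratic forms on the tangent spaces of $M$, and consider the Lagrangian $L(x,v)=Q_x(v)-U(x)$ on $TM$. Then $(p,0)$ is a Lyapunov unstable equilibrium point of the Euler--Lagrange dynamics of $L$. Explicitly: the constant curve at $p$ is a solution of the Euler--Lagrange equations $$\frac{d}{dt}\frac{\partial L}{\partial v_i}(\gamma,\dot\gamma)-\frac{\partial L}{\partial x_i}(\gamma,\dot\gamma)=0,\qquad i=1,\dots,n,$$ and it is not true that for every neighbourhood $W$ of $(p,0)$ in $TM$ there is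 a neighbourhood $W'\subset W$ of $(p,0)$ such that every solution $\gamma$, defined on an open interval $J\ni 0$, with $(\gamma(0),\dot\gamma(0))\in W'$ satisfies $(\gamma(t),\dot\gamma(t))\in W$ for all $t\in J$ with $t\ge 0$. -/

import Mathlib

open scoped Manifold ContDiff Topology

noncomputable section

namespace Mechanics

variable {n : ℕ} {M : Type*} [TopologicalSpace M] [ChartedSpace (EuclideanSpace ℝ (Fin n)) M]

/-- A kinetic term on `M`: a smooth section `x ↦ Q_x` of positive definite quadratic forms on the
tangent spaces. Smoothness of the section is smoothness of the function `(x, v) ↦ Q_x(v)` on the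
tangent bundle (by polarization, the same as smoothness of the coefficients of `Q` in charts). -/
structure KineticTerm (n : ℕ) (M : Type*) [TopologicalSpace M]
    [ChartedSpace (EuclideanSpace ℝ (Fin n)) M] [IsManifold (𝓡 n) ∞ M] where
  /-- the quadratic form at each point -/
  form : ∀ x : M, QuadraticForm ℝ (TangentSpace (𝓡 n) x)
  posDef : ∀ x : M, (form x).PosDef
  smooth : ContMDiff (𝓡 n).tangent 𝓘(ℝ, ℝ) ∞
    (fun w : TangentBundle (𝓡 n) M => form w.proj w.snd)

/-- The mechanical Lagrangian `L(x, v) = Q_x(v) - U(x)` on the tangent bundle. -/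
def KineticTerm.lagrangian [IsManifold (𝓡 n) ∞ M] (Q : KineticTerm n M) (U : M → ℝ) :
    TangentBundle (𝓡 n) M → ℝ :=
  fun w => Q.form w.proj w.snd - U w.proj

/-- The Lagrangian `L` read in the chart `e`, as a function of the coordinates `x` of the position
and the coordinates `v` of the velocity. -/
def lagrangianInChart (L : TangentBundle (𝓡 n) M → ℝ)
    (e : OpenPartialHomeomorph M (EuclideanSpace ℝ (Fin n))) (x v : EuclideanSpace ℝ (Fin n)) : ℝ :=
  L ⟨e.symm x, mfderiv (𝓡 n) (𝓡 n) e.symm x v⟩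

/-- The Euler-Lagrange equations `d/dt (∂L/∂v_i) - ∂L/∂x_i = 0`, `i = 1, …, n`, of the curve `γ`
in the chart `e` at time `t`. The equality is one of linear functionals on `ℝⁿ`, whose values on
the standard basis are the `n` equations. -/
def EulerLagrangeAt (L : TangentBundle (𝓡 n) M → ℝ)
    (e : OpenPartialHomeomorph M (EuclideanSpace ℝ (Fin n))) (γ : ℝ → M) (t : ℝ) : Prop :=
  HasDerivAt
    (fun s : ℝ => fderiv ℝ (fun v => lagrangianInChart L e (e (γ s)) v) (deriv (e ∘ γ) s))
    (fderiv ℝ (fun x => lagrangianInChart L e x (deriv (e ∘ γ) t)) (e (γ t)))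
    t

/-- `γ` restricted to the open interval `J` is a motion of the Lagrangian dynamics of `L`: a `C²`
curve satisfying the Euler-Lagrange equations at every time, in every smooth chart around the
current position. Values of `γ` outside of `J` are irrelevant. -/
structure IsMotionOn (L : TangentBundle (𝓡 n) M → ℝ) (γ : ℝ → M) (J : Set ℝ) : Prop where
  isOpen : IsOpen J
  ordConnected : J.OrdConnected
  contMDiffOn : ContMDiffOn 𝓘(ℝ, ℝ) (𝓡 n) 2 γ J
  eulerLagrange : ∀ t ∈ J, ∀ e ∈ IsManifold.maximalAtlas (𝓡 n) ∞ M, γ t ∈ e.source →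
    EulerLagrangeAt L e γ t

/-- The phase point `(γ(t), γ'(t))` of a curve in the tangent bundle. -/
def phasePoint (n : ℕ) {M : Type*} [TopologicalSpace M]
    [ChartedSpace (EuclideanSpace ℝ (Fin n)) M] (γ : ℝ → M) (t : ℝ) : TangentBundle (𝓡 n) M :=
  ⟨γ t, mfderiv 𝓘(ℝ, ℝ) (𝓡 n) γ t (1 : ℝ)⟩

/-- The point `(p, 0)` of the phase space. -/
def restPoint (n : ℕ) {M : Type*} [TopologicalSpace M]
    [ChartedSpace (EuclideanSpace ℝ (Fin n)) M] (p : M) : TangentBundle (𝓡 n) M :=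
  ⟨p, (0 : TangentSpace (𝓡 n) p)⟩

/-- `(p, 0)` is an equilibrium point: the constant curve at `p` is a motion. -/
def IsEquilibrium (L : TangentBundle (𝓡 n) M → ℝ) (p : M) : Prop :=
  IsMotionOn L (fun _ : ℝ => p) Set.univ

/-- `(p, 0)` is Lyapunov stable: for every neighbourhood `W` of `(p, 0)` in the phase space there
is a smaller neighbourhood `W'` such that no orbit starting in `W'` leaves `W` in future time. -/
def IsLyapunovStable [IsManifold (𝓡 n) ∞ M] (L : TangentBundle (𝓡 n) M → ℝ) (p : M) : Prop :=
  ∀ W ∈ 𝓝 (restPoint n p), ∃ W' ∈ 𝓝 (restPoint n p), W' ⊆ W ∧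
    ∀ (γ : ℝ → M) (J : Set ℝ), IsMotionOn L γ J → 0 ∈ J → phasePoint n γ 0 ∈ W' →
      ∀ t ∈ J, 0 ≤ t → phasePoint n γ t ∈ W

/-- `(p, 0)` is a Lyapunov unstable equilibrium point. -/
def IsLyapunovUnstableEquilibrium [IsManifold (𝓡 n) ∞ M] (L : TangentBundle (𝓡 n) M → ℝ)
    (p : M) : Prop :=
  IsEquilibrium L p ∧ ¬ IsLyapunovStable L p

/-- The vector field `V` is locally Lipschitz continuous on the open set `A`: its coordinate
expression in every smooth chart is locally Lipschitz. -/
def IsLocallyLipschitzFieldOn (V : ∀ x : M, TangentSpace (𝓡 n) x) (A : Set M) : Prop :=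
  ∀ e ∈ IsManifold.maximalAtlas (𝓡 n) ∞ M,
    LocallyLipschitzOn (e.target ∩ e.symm ⁻¹' A)
      (fun y : EuclideanSpace ℝ (Fin n) =>
        (mfderiv (𝓡 n) (𝓡 n) e (e.symm y) (V (e.symm y)) : EuclideanSpace ℝ (Fin n)))

/-- The vector field `V` is weakly logarithmic for `U` on the open set `A`: `V(U) = P U` on `A`
for a function `P` that is bounded on the compact subsets of `A`. -/
def IsWeaklyLogarithmicOn (U : M → ℝ) (V : ∀ x : M, TangentSpace (𝓡 n) x) (A : Set M) : Prop :=
  ∃ P : M → ℝ, (∀ K : Set M, K ⊆ A → IsCompact K → Bornology.IsBounded (P '' K)) ∧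
    ∀ x ∈ A, (mfderiv (𝓡 n) 𝓘(ℝ, ℝ) U x (V x) : ℝ) = P x * U x

end Mechanics

end

/-!
A motion that starts at `p` with the small velocity `ε V(p)` drifts away from `p` along `V`.

In a chart the Lagrangian is `G_x(v, v) - u(x)`. Since `u(p) = 0`, the energy
`G_x(v, v) + u(x)` of this motion is of order `ε²`, and as both of its terms are nonnegative, the
speed stays of order `ε` and `u` of order `ε²`. Consider the momentum along the field,
`J = 2 G_x(v, V(x))`, which is of order `ε` at time `0`. By the Euler-Lagrange equations its rate
of change consists of terms quadratic in `v` and of `-V(u) = -P u`, all of order `ε²`. (As `V` is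
only Lipschitz, `J` may fail to be differentiable, and the rate is a bound on its difference
quotients.) Hence `J` stays of order `ε` up to a time of order `1 / ε`
(`Mechanics.UniformBounds.momentum_ge`). Close to `p`, the momentum `J` differs from the derivative
of the fixed linear function `2 G_p(V(p), ·)` along the motion by a small multiple of `ε`, so
during that time this function would increase by an amount independent of `ε`, which a
sufficiently small ball around `p` does not permit
(`Mechanics.IsLogarithmicSystem.exists_escape_time`).

For the motion to be available for such a long time, the equations of motion are cut off outside a
compact set of positions and velocities, which makes the solutions global. The speed estimate shows
that a solution confined to the small ball never feels the cut-off
(`Mechanics.IsLogarithmicSystem.exists_motion_leaving_ball`). Finally, a solution found in one chart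
satisfies the Euler-Lagrange equations in all of them, because these equations are invariant under
changes of coordinates (`Mechanics.hasDerivAt_momentum_of_change`).
-/

-- The norm on triple spaces of continuous linear maps, where `fderiv ℝ G x` lives for a
-- bilinear-form-valued `G`, is only found by instance search at this depth.
set_option maxSynthPendingDepth 3

namespace Mechanics

open Set Metric

/-! ### Ordinary differential equations with a cut-off -/

/-- A `C¹` vector field agrees on a ball with a compactly supported, hence globally Lipschitz and
bounded, one. -/
theorem exists_contDiff_hasCompactSupport_eqOn_closedBall {X : Type*} [NormedAddCommGroup X]
    [NormedSpace ℝ X] [FiniteDimensional ℝ X] {F : X → X} {s : Set X} (hs : IsOpen s)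
    (hF : ContDiffOn ℝ 1 F s) {z₀ : X} {R : ℝ} (hR : 0 < R) (hRs : closedBall z₀ (2 * R) ⊆ s) :
    ∃ F' : X → X, ContDiff ℝ 1 F' ∧ HasCompactSupport F' ∧ EqOn F' F (closedBall z₀ R) := by
  let b : ContDiffBump z₀ := ⟨R, 2 * R, hR, by linarith⟩
  have htb : tsupport (b : X → ℝ) ⊆ s := by rw [b.tsupport_eq]; exact hRs
  refine ⟨fun z => b z • F z, ?_, b.hasCompactSupport.smul_right, fun z hz => ?_⟩
  · rw [contDiff_iff_contDiffAt]
    intro z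
    by_cases hz : z ∈ s
    · exact b.contDiffAt.smul (hF.contDiffAt (hs.mem_nhds hz))
    · have h0 : (fun z => b z • F z) =ᶠ[𝓝 z] fun _ => 0 := by
        filter_upwards [(isClosed_tsupport (b : X → ℝ)).isOpen_compl.mem_nhds
          (fun h => hz (htb h))] with y hy
        rw [image_eq_zero_of_notMem_tsupport hy, zero_smul]
      exact contDiffAt_const.congr_of_eventuallyEq h0
  · simp only
    rw [b.one_of_mem_closedBall hz, one_smul]

theorem exists_hasDerivAt_of_hasCompactSupport {X : Type*} [NormedAddCommGroup X]
    [NormedSpace ℝ X] [CompleteSpace X] {F : X → X} (hF : ContDiff ℝ 1 F)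
    (hc : HasCompactSupport F) {T : ℝ} (hT : 0 < T) (z₁ : X) :
    ∃ z : ℝ → X, z 0 = z₁ ∧ ∀ t ∈ Ioo (-T) T, HasDerivAt z (F (z t)) t := by
  obtain ⟨K, hK⟩ := hF.lipschitzWith_of_hasCompactSupport (𝕂 := ℝ) hc one_ne_zero
  obtain ⟨C, hC⟩ := hc.exists_bound_of_continuous hF.continuous
  have hC0 : 0 ≤ C := (norm_nonneg _).trans (hC z₁)
  have h0 : (0 : ℝ) ∈ Icc (-T) T := ⟨by linarith, hT.le⟩
  -- The bound `C` on the speed confines the solution to the ball of radius `C * T`.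
  have hPL : IsPicardLindelof (fun _ : ℝ => F) (⟨0, h0⟩ : Icc (-T) T) z₁
      (⟨C * T, by positivity⟩) 0 ⟨C, hC0⟩ K :=
    { lipschitzOnWith := fun _ _ => hK.lipschitzOnWith
      continuousOn := fun _ _ => continuousOn_const
      norm_le := fun _ _ x _ => hC x
      mul_max_le := by
        change C * max (T - 0) (0 - -T) ≤ C * T - 0
        simp }
  obtain ⟨z, hz0, hz⟩ := hPL.exists_eq_forall_mem_Icc_hasDerivWithinAt₀
  exact ⟨z, hz0, fun t ht => (hz t (Ioo_subset_Icc_self ht)).hasDerivAt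
    (Icc_mem_nhds ht.1 ht.2)⟩

/-! ### Mechanical Lagrangians in coordinates -/

section Coordinates

variable {E : Type*} [NormedAddCommGroup E] [NormedSpace ℝ E]

/-- The derivative `∂L/∂x` of the Lagrangian `L(x, v) = G_x(v, v) - u(x)`. -/
noncomputable def force (G : E → E →L[ℝ] E →L[ℝ] ℝ) (u : E → ℝ) (x v : E) : E →L[ℝ] ℝ :=
  ((fderiv ℝ G x).flip v).flip v - fderiv ℝ u x

theorem force_apply (G : E → E →L[ℝ] E →L[ℝ] ℝ) (u : E → ℝ) (x v w : E) :
    force G u x v w = fderiv ℝ G x w v v - fderiv ℝ u x w := rfl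

/-- A positive definite bilinear form on a finite dimensional space identifies the space with its
dual. -/
theorem exists_continuousLinearEquiv_of_pos [FiniteDimensional ℝ E] (B : E →L[ℝ] E →L[ℝ] ℝ)
    (hB : ∀ v, v ≠ 0 → 0 < B v v) : ∃ e : E ≃L[ℝ] (E →L[ℝ] ℝ), (e : E →L[ℝ] E →L[ℝ] ℝ) = B := by
  have hinj : Function.Injective B := by
    rw [injective_iff_map_eq_zero]
    intro v hv
    by_contra h
    have := hB v h
    simp [hv] at this
  have hdim : Module.finrank ℝ E = Module.finrank ℝ (E →L[ℝ] ℝ) := by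
    rw [← (LinearMap.toContinuousLinearMap (𝕜 := ℝ) (E := E) (F' := ℝ)).finrank_eq]
    exact (Subspace.dual_finrank_eq (K := ℝ) (V := E)).symm
  exact ⟨(LinearMap.linearEquivOfInjective (B : E →ₗ[ℝ] E →L[ℝ] ℝ) hinj
    hdim).toContinuousLinearEquiv, rfl⟩

/-- The Euler-Lagrange equations of a mechanical Lagrangian, solved for the acceleration. -/
theorem exists_acceleration [FiniteDimensional ℝ E] {G : E → E →L[ℝ] E →L[ℝ] ℝ} {u : E → ℝ}
    {O : Set E} (hO : IsOpen O) (hG : ContDiffOn ℝ 2 G O) (hu : ContDiffOn ℝ 2 u O)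
    (hpos : ∀ x ∈ O, ∀ v, v ≠ 0 → 0 < G x v v) :
    ∃ a : E × E → E, ContDiffOn ℝ 1 a (O ×ˢ univ) ∧ ∀ x ∈ O, ∀ v,
      (2 : ℝ) • (fderiv ℝ G x v v + G x (a (x, v))) = force G u x v := by
  have hGd : ContDiffOn ℝ 1 (fun z : E × E => fderiv ℝ G z.1) (O ×ˢ univ) :=
    (hG.fderiv_of_isOpen hO (by norm_num)).comp contDiffOn_fst fun z hz => hz.1
  have hud : ContDiffOn ℝ 1 (fun z : E × E => fderiv ℝ u z.1) (O ×ˢ univ) :=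
    (hu.fderiv_of_isOpen hO (by norm_num)).comp contDiffOn_fst fun z hz => hz.1
  have hforce : ContDiffOn ℝ 1 (fun z : E × E => force G u z.1 z.2) (O ×ˢ univ) := by
    rw [contDiffOn_clm_apply]
    intro w
    simp only [force_apply]
    exact (((hGd.clm_apply contDiffOn_const).clm_apply contDiffOn_snd).clm_apply
      contDiffOn_snd).sub (hud.clm_apply contDiffOn_const)
  have hinv : ContDiffOn ℝ 1 (fun z : E × E => (G z.1).inverse) (O ×ˢ univ) := by
    intro z hz
    obtain ⟨e, he⟩ := exists_continuousLinearEquiv_of_pos (G z.1) (hpos z.1 hz.1)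
    have h1 : ContDiffAt ℝ 1 ContinuousLinearMap.inverse (G z.1) := by
      rw [← he]; exact contDiffAt_map_inverse e
    exact h1.comp_contDiffWithinAt z
      (((hG.of_le (by norm_num)).comp contDiffOn_fst fun z hz => hz.1) z hz)
  refine ⟨fun z => (G z.1).inverse ((2⁻¹ : ℝ) • force G u z.1 z.2 - fderiv ℝ G z.1 z.2 z.2),
    hinv.clm_apply ((hforce.const_smul _).sub
      ((hGd.clm_apply contDiffOn_snd).clm_apply contDiffOn_snd)), fun x hx v => ?_⟩
  obtain ⟨e, he⟩ := exists_continuousLinearEquiv_of_pos (G x) (hpos x hx)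
  simp only [← he, ContinuousLinearMap.inverse_equiv, ContinuousLinearEquiv.coe_coe,
    ContinuousLinearEquiv.apply_symm_apply]
  rw [add_sub_cancel, smul_smul]
  norm_num

/-- At time `t`, the curve `x` has velocity `v` and satisfies the Euler-Lagrange equations of the
Lagrangian `G_x(v, v) - u(x)`, the derivative of the momentum `2 G_x(v, ·)` being expanded. -/
structure IsMechanicalAt (G : E → E →L[ℝ] E →L[ℝ] ℝ) (u : E → ℝ) (x v : ℝ → E) (t : ℝ) :
    Prop where
  hasDerivAt_pos : HasDerivAt x (v t) t
  exists_accel : ∃ a, HasDerivAt v a t ∧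
    (2 : ℝ) • (fderiv ℝ G (x t) (v t) (v t) + G (x t) a) = force G u (x t) (v t)

namespace IsMechanicalAt

variable {G : E → E →L[ℝ] E →L[ℝ] ℝ} {u : E → ℝ} {x v : ℝ → E} {t : ℝ}

/-- The Euler-Lagrange equations in their usual form: the derivative of the momentum is the
force. -/
theorem hasDerivAt_momentum (h : IsMechanicalAt G u x v t) (hG : DifferentiableAt ℝ G (x t)) :
    HasDerivAt (fun s => (2 : ℝ) • G (x s) (v s)) (force G u (x t) (v t)) t := by
  obtain ⟨a, ha, hEL⟩ := h.exists_accel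
  rw [← hEL]
  exact ((hG.hasFDerivAt.comp_hasDerivAt t h.hasDerivAt_pos).clm_apply ha).const_smul (2 : ℝ)

/-- Conservation of energy. -/
theorem hasDerivAt_energy (h : IsMechanicalAt G u x v t) (hG : DifferentiableAt ℝ G (x t))
    (hu : DifferentiableAt ℝ u (x t)) (hsymm : ∀ v w, G (x t) v w = G (x t) w v) :
    HasDerivAt (fun s => G (x s) (v s) (v s) + u (x s)) 0 t := by
  obtain ⟨a, ha, hEL⟩ := h.exists_accel
  have h1 := ((hG.hasFDerivAt.comp_hasDerivAt t h.hasDerivAt_pos).clm_apply ha).clm_apply ha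
  have h2 := h1.add (hu.hasFDerivAt.comp_hasDerivAt t h.hasDerivAt_pos)
  refine h2.congr_deriv ?_
  have h3 := congrArg (fun p : E →L[ℝ] ℝ => p (v t)) hEL
  simp only [force_apply, smul_apply, add_apply, smul_eq_mul] at h3
  simp only [add_apply, Function.comp]
  rw [hsymm (v t) a]
  linarith

end IsMechanicalAt

/-! ### A lower bound for the momentum along a weakly logarithmic field -/

/-- For a differentiable covector-valued curve `q` and a merely Lipschitz vector field `Y`, the
pairing of `q` with `Y` along a differentiable curve `x` need not be differentiable, but its right
difference quotients are still controlled. -/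
theorem frequently_slope_neg_apply_lt {q : ℝ → E →L[ℝ] ℝ} {q' : E →L[ℝ] ℝ} {x : ℝ → E} {x' : E}
    {Y : E → E} {s : Set E} {ℓ : NNReal} {t r : ℝ} (hq : HasDerivAt q q' t)
    (hx : HasDerivAt x x' t) (hY : LipschitzOnWith ℓ Y s) (hxs : x t ∈ s)
    (hxs' : ∀ᶠ τ in 𝓝[>] t, x τ ∈ s) (hr : -q' (Y (x t)) + ‖q t‖ * (ℓ * ‖x'‖) < r) :
    ∃ᶠ τ in 𝓝[>] t, slope (fun τ => -q τ (Y (x τ))) t τ < r := by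
  apply Filter.Eventually.frequently
  have hqs : Filter.Tendsto (slope q t) (𝓝[>] t) (𝓝 q') :=
    (hasDerivAt_iff_tendsto_slope.1 hq).mono_left (nhdsWithin_mono _ fun _ h => ne_of_gt h)
  have hxsl : Filter.Tendsto (slope x t) (𝓝[>] t) (𝓝 x') :=
    (hasDerivAt_iff_tendsto_slope.1 hx).mono_left (nhdsWithin_mono _ fun _ h => ne_of_gt h)
  have hYx : Filter.Tendsto (fun τ => Y (x τ)) (𝓝[>] t) (𝓝 (Y (x t))) := by
    have h1 : Filter.Tendsto x (𝓝[>] t) (𝓝[s] (x t)) :=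
      tendsto_nhdsWithin_iff.2 ⟨hx.continuousAt.tendsto.mono_left nhdsWithin_le_nhds, hxs'⟩
    exact ((hY.continuousOn (x t) hxs).tendsto).comp h1
  have hlim : Filter.Tendsto
      (fun τ => -slope q t τ (Y (x τ)) + ‖q t‖ * (ℓ * ‖slope x t τ‖)) (𝓝[>] t)
      (𝓝 (-q' (Y (x t)) + ‖q t‖ * (ℓ * ‖x'‖))) :=
    ((isBoundedBilinearMap_apply.continuous.tendsto (q', Y (x t))).comp
      (hqs.prodMk_nhds hYx)).neg.add ((hxsl.norm.const_mul _).const_mul _)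
  filter_upwards [hlim.eventually (gt_mem_nhds hr), hxs', self_mem_nhdsWithin] with τ hτ hτs hτt
  refine lt_of_le_of_lt ?_ hτ
  have hpos : 0 < τ - t := sub_pos.2 hτt
  have hdist : ‖Y (x τ) - Y (x t)‖ ≤ ℓ * ‖x τ - x t‖ := hY.norm_sub_le hτs hxs
  have hop : -q t (Y (x τ) - Y (x t)) ≤ ‖q t‖ * (ℓ * ‖x τ - x t‖) :=
    (neg_le_abs _).trans (((q t).le_opNorm _).trans
      (mul_le_mul_of_nonneg_left hdist (norm_nonneg _)))
  have hnorm : ‖slope x t τ‖ = (τ - t)⁻¹ * ‖x τ - x t‖ := by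
    rw [slope_def_module, norm_smul, norm_inv, Real.norm_of_nonneg hpos.le]
  rw [hnorm, slope_def_module, slope_def_module]
  simp only [smul_apply, sub_apply, smul_eq_mul]
  have hid : (τ - t)⁻¹ * (-q τ (Y (x τ)) - -q t (Y (x t)))
      = -((τ - t)⁻¹ * (q τ (Y (x τ)) - q t (Y (x τ))))
        + (τ - t)⁻¹ * -q t (Y (x τ) - Y (x t)) := by
    rw [map_sub]; ring
  rw [hid]
  have := mul_le_mul_of_nonneg_left hop (inv_nonneg.2 hpos.le)
  nlinarith [this]

/-- Bounds, uniform over a set `s` of positions, on a mechanical Lagrangian `G_x(v, v) - u(x)` and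
on a vector field `Y` which is weakly logarithmic for `u`. -/
structure UniformBounds (G : E → E →L[ℝ] E →L[ℝ] ℝ) (u : E → ℝ) (Y : E → E) (s : Set E)
    (c g g' y P : ℝ) (ℓ : NNReal) : Prop where
  c_pos : 0 < c
  P_nonneg : 0 ≤ P
  diffG : ∀ x ∈ s, DifferentiableAt ℝ G x
  diffu : ∀ x ∈ s, DifferentiableAt ℝ u x
  symm : ∀ x ∈ s, ∀ v w, G x v w = G x w v
  coercive : ∀ x ∈ s, ∀ v, c * ‖v‖ ^ 2 ≤ G x v v
  nonneg : ∀ x ∈ s, 0 ≤ u x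
  norm_le : ∀ x ∈ s, ‖G x‖ ≤ g
  norm_fderiv_le : ∀ x ∈ s, ‖fderiv ℝ G x‖ ≤ g'
  norm_field_le : ∀ x ∈ s, ‖Y x‖ ≤ y
  lipschitz : LipschitzOnWith ℓ Y s
  logarithmic : ∀ x ∈ s, |fderiv ℝ u x (Y x)| ≤ P * u x

namespace UniformBounds

variable {G : E → E →L[ℝ] E →L[ℝ] ℝ} {u : E → ℝ} {Y : E → E} {s : Set E} {c g g' y P : ℝ}
  {ℓ : NNReal} {x v : ℝ → E} {t₁ : ℝ}

/-- The speed and the potential are controlled by the initial energy. -/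
theorem energy_le (hB : UniformBounds G u Y s c g g' y P ℓ)
    (hm : ∀ t ∈ Icc 0 t₁, IsMechanicalAt G u x v t) (hs : ∀ t ∈ Icc 0 t₁, x t ∈ s) :
    ∀ t ∈ Icc 0 t₁, c * ‖v t‖ ^ 2 + u (x t) ≤ G (x 0) (v 0) (v 0) + u (x 0) := by
  intro t ht
  have hd : ∀ τ ∈ Icc 0 t₁, HasDerivAt (fun s => G (x s) (v s) (v s) + u (x s)) 0 τ :=
    fun τ hτ => (hm τ hτ).hasDerivAt_energy (hB.diffG _ (hs τ hτ)) (hB.diffu _ (hs τ hτ))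
      (hB.symm _ (hs τ hτ))
  have hc := constant_of_has_deriv_right_zero
    (fun τ hτ => (hd τ hτ).continuousAt.continuousWithinAt)
    (fun τ hτ => (hd τ (Ico_subset_Icc_self hτ)).hasDerivWithinAt) t ht
  rw [← hc]
  linarith [hB.coercive _ (hs t ht) (v t)]

/-- The momentum of a motion along a weakly logarithmic field decreases at a rate at most
proportional to the energy. -/
theorem momentum_ge (hB : UniformBounds G u Y s c g g' y P ℓ)
    (hm : ∀ t ∈ Icc 0 t₁, IsMechanicalAt G u x v t) (hs : ∀ t ∈ Icc 0 t₁, x t ∈ s) :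
    ∀ t ∈ Icc 0 t₁, 2 * G (x 0) (v 0) (Y (x 0))
      - ((g' * y + 2 * g * ℓ) / c + P) * (G (x 0) (v 0) (v 0) + u (x 0)) * t
      ≤ 2 * G (x t) (v t) (Y (x t)) := by
  set e₀ := G (x 0) (v 0) (v 0) + u (x 0) with he₀
  set K := (g' * y + 2 * g * ℓ) / c + P with hK
  have hq : ∀ t ∈ Icc 0 t₁, HasDerivAt (fun s => (2 : ℝ) • G (x s) (v s))
      (force G u (x t) (v t)) t := fun t ht =>
    (hm t ht).hasDerivAt_momentum (hB.diffG _ (hs t ht))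
  have hxc : ContinuousOn x (Icc 0 t₁) := fun t ht =>
    (hm t ht).hasDerivAt_pos.continuousAt.continuousWithinAt
  have hbound := image_le_of_liminf_slope_right_le_deriv_boundary
    (f := fun τ => -((2 : ℝ) • G (x τ) (v τ)) (Y (x τ))) (a := 0) (b := t₁)
    (B := fun τ => -((2 : ℝ) • G (x 0) (v 0)) (Y (x 0)) + K * e₀ * τ) (B' := fun _ => K * e₀)
    ?_ (by simp) (by fun_prop) (fun τ _ => ?_) ?_
  · intro t ht
    have := hbound ht
    simp only [smul_apply, smul_eq_mul] at this
    linarith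
  · have hqc : ContinuousOn (fun s => (2 : ℝ) • G (x s) (v s)) (Icc 0 t₁) := fun t ht =>
      (hq t ht).continuousAt.continuousWithinAt
    exact (hqc.clm_apply (hB.lipschitz.continuousOn.comp hxc hs)).neg
  · have := ((hasDerivAt_id τ).const_mul (K * e₀)).const_add (-((2 : ℝ) • G (x 0) (v 0)) (Y (x 0)))
    simpa using this.hasDerivWithinAt
  · intro t ht r hr
    have ht' := Ico_subset_Icc_self ht
    have hst := hs t ht'
    refine frequently_slope_neg_apply_lt (hq t ht') (hm t ht').hasDerivAt_pos hB.lipschitz hst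
      ?_ (lt_of_le_of_lt ?_ hr)
    · filter_upwards [Ioo_mem_nhdsGT ht.2] with τ hτ
      exact hs τ ⟨ht.1.trans hτ.1.le, hτ.2.le⟩
    · have hE := hB.energy_le hm hs t ht'
      have hu0 := hB.nonneg _ hst
      have hg : 0 ≤ g := (norm_nonneg _).trans (hB.norm_le _ hst)
      have hg' : 0 ≤ g' := (norm_nonneg _).trans (hB.norm_fderiv_le _ hst)
      have hy : 0 ≤ y := (norm_nonneg _).trans (hB.norm_field_le _ hst)
      have hc := hB.c_pos
      have hv2 : ‖v t‖ ^ 2 ≤ e₀ / c := by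
        rw [le_div_iff₀ hc]; linarith
      have hue : u (x t) ≤ e₀ := by nlinarith [sq_nonneg ‖v t‖]
      have h1 : -fderiv ℝ G (x t) (Y (x t)) (v t) (v t) ≤ g' * y * ‖v t‖ ^ 2 := by
        refine (neg_le_abs _).trans (((fderiv ℝ G (x t) (Y (x t))).le_opNorm₂ _ _).trans ?_)
        have : ‖fderiv ℝ G (x t) (Y (x t))‖ ≤ g' * y :=
          ((fderiv ℝ G (x t)).le_opNorm _).trans
            (mul_le_mul (hB.norm_fderiv_le _ hst) (hB.norm_field_le _ hst) (norm_nonneg _) hg')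
        calc _ = ‖fderiv ℝ G (x t) (Y (x t))‖ * ‖v t‖ ^ 2 := by ring
          _ ≤ _ := by gcongr
      have h2 : fderiv ℝ u (x t) (Y (x t)) ≤ P * u (x t) :=
        (le_abs_self _).trans (hB.logarithmic _ hst)
      have h3 : ‖(2 : ℝ) • G (x t) (v t)‖ ≤ 2 * (g * ‖v t‖) := by
        rw [norm_smul, Real.norm_ofNat]
        gcongr
        exact (G (x t)).le_of_opNorm_le (hB.norm_le _ hst) _
      have h4 : ‖(2 : ℝ) • G (x t) (v t)‖ * (ℓ * ‖v t‖) ≤ 2 * g * ℓ * ‖v t‖ ^ 2 := by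
        calc _ ≤ 2 * (g * ‖v t‖) * (ℓ * ‖v t‖) := by gcongr
          _ = _ := by ring
      rw [force_apply]
      have h5 : (g' * y + 2 * g * ℓ) * ‖v t‖ ^ 2 ≤ (g' * y + 2 * g * ℓ) * (e₀ / c) :=
        mul_le_mul_of_nonneg_left hv2 (by positivity)
      have h6 : P * u (x t) ≤ P * e₀ := mul_le_mul_of_nonneg_left hue hB.P_nonneg
      have h7 : K * e₀ = (g' * y + 2 * g * ℓ) * (e₀ / c) + P * e₀ := by rw [hK]; ring
      rw [h7]
      linarith

end UniformBounds

/-! ### Escape from a neighbourhood of the equilibrium -/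

theorem exists_coercive_of_pos [FiniteDimensional ℝ E] (B : E →L[ℝ] E →L[ℝ] ℝ)
    (hB : ∀ v, v ≠ 0 → 0 < B v v) : ∃ c, 0 < c ∧ ∀ v, c * ‖v‖ ^ 2 ≤ B v v := by
  have hcont : Continuous fun v => B v v := by fun_prop
  obtain ⟨c, hc, hmin⟩ := (isCompact_sphere (0 : E) 1).exists_forall_le' hcont.continuousOn
    (a := 0) fun v hv => hB v (ne_of_mem_sphere hv one_ne_zero)
  refine ⟨c, hc, fun v => ?_⟩
  rcases eq_or_ne v 0 with rfl | hv
  · simp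
  have hv' : ‖v‖ ≠ 0 := norm_ne_zero_iff.2 hv
  have h := hmin (‖v‖⁻¹ • v) (by simp [norm_smul, hv'])
  simp only [map_smul, smul_apply, smul_eq_mul] at h
  calc c * ‖v‖ ^ 2 ≤ ‖v‖⁻¹ * (‖v‖⁻¹ * B v v) * ‖v‖ ^ 2 := by gcongr
    _ = B v v := by field_simp

/-- The data of a mechanical system on an open set `O` of a vector space, with a nonnegative
potential vanishing at `x₀` and a locally Lipschitz weakly logarithmic field `Y` which does not
vanish at `x₀`. -/
structure IsLogarithmicSystem (G : E → E →L[ℝ] E →L[ℝ] ℝ) (u : E → ℝ) (Y : E → E) (P : E → ℝ)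
    (O : Set E) (x₀ : E) : Prop where
  isOpen : IsOpen O
  mem : x₀ ∈ O
  contDiffOn_metric : ContDiffOn ℝ 2 G O
  contDiffOn_potential : ContDiffOn ℝ 2 u O
  symm : ∀ x ∈ O, ∀ v w, G x v w = G x w v
  pos : ∀ x ∈ O, ∀ v, v ≠ 0 → 0 < G x v v
  nonneg : ∀ x ∈ O, 0 ≤ u x
  potential_eq_zero : u x₀ = 0
  locallyLipschitz : LocallyLipschitzOn O Y
  field_ne_zero : Y x₀ ≠ 0
  fderiv_field : ∀ x ∈ O, fderiv ℝ u x (Y x) = P x * u x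
  bounded : ∀ K, K ⊆ O → IsCompact K → Bornology.IsBounded (P '' K)

namespace IsLogarithmicSystem

variable {G : E → E →L[ℝ] E →L[ℝ] ℝ} {u : E → ℝ} {Y : E → E} {P : E → ℝ} {O : Set E} {x₀ : E}

theorem exists_uniformBounds [FiniteDimensional ℝ E] (h : IsLogarithmicSystem G u Y P O x₀) :
    ∃ R, 0 < R ∧ closedBall x₀ (2 * R) ⊆ O ∧
      ∃ c g g' y C ℓ, UniformBounds G u Y (closedBall x₀ R) c g g' y C ℓ := by
  have hO : O ∈ 𝓝 x₀ := h.isOpen.mem_nhds h.mem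
  obtain ⟨c, hc, hcoer⟩ := exists_coercive_of_pos (G x₀) (h.pos x₀ h.mem)
  obtain ⟨ℓ, t, ht, hℓ⟩ := h.locallyLipschitz h.mem
  rw [nhdsWithin_eq_nhds.2 hO] at ht
  have hGc : ContinuousAt G x₀ := h.contDiffOn_metric.continuousOn.continuousAt hO
  have hGc' : ContinuousAt (fderiv ℝ G) x₀ :=
    ((h.contDiffOn_metric.fderiv_of_isOpen (m := 1) h.isOpen (by norm_num)).continuousOn
      ).continuousAt hO
  have hYc : ContinuousAt Y x₀ := hℓ.continuousOn.continuousAt ht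
  have hev : ∀ᶠ x in 𝓝 x₀, x ∈ t ∧ ‖G x‖ ≤ ‖G x₀‖ + 1 ∧ ‖fderiv ℝ G x‖ ≤ ‖fderiv ℝ G x₀‖ + 1 ∧
      ‖Y x‖ ≤ ‖Y x₀‖ + 1 ∧ ‖G x - G x₀‖ ≤ c / 2 := by
    have h5 : Filter.Tendsto (fun x => ‖G x - G x₀‖) (𝓝 x₀) (𝓝 0) := by
      have := (hGc.sub (continuousAt_const (y := G x₀))).norm
      simpa [ContinuousAt] using this
    filter_upwards [ht, hGc.norm.eventually_le_const (lt_add_one _),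
      hGc'.norm.eventually_le_const (lt_add_one _), hYc.norm.eventually_le_const (lt_add_one _),
      h5.eventually_le_const (half_pos hc)] with x h1 h2 h3 h4 h5
    exact ⟨h1, h2, h3, h4, h5⟩
  obtain ⟨R₁, hR₁, hR₁s⟩ := nhds_basis_closedBall.mem_iff.1 (Filter.inter_mem hO hev)
  have hsub : closedBall x₀ (R₁ / 2) ⊆ closedBall x₀ R₁ :=
    closedBall_subset_closedBall (by linarith)
  obtain ⟨C, hC⟩ := (h.bounded (closedBall x₀ R₁) (fun x hx => (hR₁s hx).1)
    (isCompact_closedBall _ _)).exists_norm_le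
  refine ⟨R₁ / 2, by positivity, fun x hx => (hR₁s (by convert hx using 2; ring)).1, c / 2,
    ‖G x₀‖ + 1, ‖fderiv ℝ G x₀‖ + 1, ‖Y x₀‖ + 1, |C|, ℓ, ?_⟩
  have hmem : ∀ x ∈ closedBall x₀ (R₁ / 2), x ∈ O := fun x hx => (hR₁s (hsub hx)).1
  refine
    { c_pos := by positivity
      P_nonneg := abs_nonneg _
      diffG := fun x hx => (h.contDiffOn_metric.contDiffAt
        (h.isOpen.mem_nhds (hmem x hx))).differentiableAt (by norm_num)
      diffu := fun x hx => (h.contDiffOn_potential.contDiffAt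
        (h.isOpen.mem_nhds (hmem x hx))).differentiableAt (by norm_num)
      symm := fun x hx => h.symm x (hmem x hx)
      coercive := fun x hx v => ?_
      nonneg := fun x hx => h.nonneg x (hmem x hx)
      norm_le := fun x hx => (hR₁s (hsub hx)).2.2.1
      norm_fderiv_le := fun x hx => (hR₁s (hsub hx)).2.2.2.1
      norm_field_le := fun x hx => (hR₁s (hsub hx)).2.2.2.2.1
      lipschitz := hℓ.mono fun x hx => (hR₁s (hsub hx)).2.1
      logarithmic := fun x hx => ?_ }
  · have h1 : -(G x - G x₀) v v ≤ c / 2 * ‖v‖ ^ 2 := by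
      refine (neg_le_abs _).trans (((G x - G x₀).le_opNorm₂ _ _).trans ?_)
      rw [mul_assoc, ← sq]
      exact mul_le_mul_of_nonneg_right (hR₁s (hsub hx)).2.2.2.2.2 (by positivity)
    have h2 := hcoer v
    simp only [sub_apply] at h1
    linarith
  · rw [h.fderiv_field x (hmem x hx), abs_mul, abs_of_nonneg (h.nonneg x (hmem x hx))]
    refine mul_le_mul_of_nonneg_right ?_ (h.nonneg x (hmem x hx))
    exact (hC _ (mem_image_of_mem _ (hsub hx))).trans (le_abs_self C)

/-- Motions which start at `x₀` with velocity `ε • Y x₀` have speed of order `ε`, and leave a small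
ball, of radius independent of `ε`, within a time of order `1 / ε`. -/
theorem exists_escape_time [FiniteDimensional ℝ E] (h : IsLogarithmicSystem G u Y P O x₀) :
    ∃ R r κ T, 0 < r ∧ r < R ∧ 0 < T ∧ closedBall x₀ (2 * R) ⊆ O ∧
      ∀ ε, 0 < ε → ∀ t₁, 0 ≤ t₁ → ∀ x v : ℝ → E, x 0 = x₀ → v 0 = ε • Y x₀ →
        (∀ t ∈ Icc 0 t₁, IsMechanicalAt G u x v t) → (∀ t ∈ Icc 0 t₁, x t ∈ closedBall x₀ r) →
        (∀ t ∈ Icc 0 t₁, ‖v t‖ ≤ κ * ε) ∧ t₁ < T / ε := by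
  obtain ⟨R, hR, hRO, c, g, g', y, C, ℓ, hB⟩ := h.exists_uniformBounds
  have hx₀R : x₀ ∈ closedBall x₀ R := mem_closedBall_self hR.le
  have hc := hB.c_pos
  have hg : 0 ≤ g := (norm_nonneg _).trans (hB.norm_le _ hx₀R)
  have hg' : 0 ≤ g' := (norm_nonneg _).trans (hB.norm_fderiv_le _ hx₀R)
  have hy : 0 ≤ y := (norm_nonneg _).trans (hB.norm_field_le _ hx₀R)
  set a := G x₀ (Y x₀) (Y x₀) with ha_def
  have ha : 0 < a := h.pos x₀ h.mem _ h.field_ne_zero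
  set K := (g' * y + 2 * g * ℓ) / c + C with hK_def
  have hK : 0 ≤ K := add_nonneg (by positivity) hB.P_nonneg
  set κ := √(a / c) with hκ_def
  have hκ : 0 < κ := Real.sqrt_pos.2 (by positivity)
  have hκ2 : κ ^ 2 = a / c := Real.sq_sqrt (by positivity)
  -- The covector field dual to `Y`: the momentum along `Y` at velocity `v` is `η x v`.
  set η : E → E →L[ℝ] ℝ := fun x => (2 : ℝ) • G x (Y x) with hη_def
  -- Up to time `T / ε` the momentum along `Y`, initially `2 * ε * a`, loses at most
  -- `K * (ε ^ 2 * a) * (T / ε) ≤ ε * a`.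
  set T := 1 / (K + 1) with hT_def
  have hT : 0 < T := by positivity
  have hηc : ContinuousAt η x₀ := by
    have h1 : ContinuousAt G x₀ := (hB.diffG x₀ hx₀R).continuousAt
    have h2 : ContinuousAt Y x₀ :=
      hB.lipschitz.continuousOn.continuousAt (closedBall_mem_nhds x₀ hR)
    exact (h1.clm_apply h2).const_smul (2 : ℝ)
  obtain ⟨δ, hδ, hδη⟩ := nhds_basis_closedBall.mem_iff.1
    (hηc (closedBall_mem_nhds (η x₀) (show 0 < a / (2 * κ) by positivity)))
  -- On the ball of radius `δ`, the error made by replacing `η x` with `η x₀` costs at most half of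
  -- the remaining momentum; the last bound makes the ball too small for the resulting advance.
  set r := min (min δ (R / 2)) (a * T / (4 * (‖η x₀‖ + 1))) with hr_def
  have hr : 0 < r := by positivity
  have hrδ : r ≤ δ := (min_le_left _ _).trans (min_le_left _ _)
  have hrR : r ≤ R / 2 := (min_le_left _ _).trans (min_le_right _ _)
  have hrT : r ≤ a * T / (4 * (‖η x₀‖ + 1)) := min_le_right _ _
  refine ⟨R, r, κ, T, hr, by linarith, hT, hRO, ?_⟩
  intro ε hε t₁ ht₁ x v hx0 hv0 hm hxr
  have hxR : ∀ t ∈ Icc 0 t₁, x t ∈ closedBall x₀ R := fun t ht =>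
    closedBall_subset_closedBall (by linarith) (hxr t ht)
  have hE0 : G (x 0) (v 0) (v 0) + u (x 0) = ε ^ 2 * a := by
    rw [hx0, hv0, h.potential_eq_zero]
    simp only [map_smul, smul_apply, smul_eq_mul, ha_def]
    ring
  have hspeed : ∀ t ∈ Icc 0 t₁, ‖v t‖ ≤ κ * ε := by
    intro t ht
    have h1 := hB.energy_le hm hxR t ht
    rw [hE0] at h1
    have h2 := hB.nonneg _ (hxR t ht)
    refine abs_le_of_sq_le_sq' ?_ (by positivity) |>.2
    rw [mul_pow, hκ2, div_mul_eq_mul_div, le_div_iff₀ hc]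
    linarith
  refine ⟨hspeed, ?_⟩
  by_contra! hlong
  have hT0 : 0 ≤ T / ε := by positivity
  have hsub : Icc 0 (T / ε) ⊆ Icc 0 t₁ := Icc_subset_Icc_right hlong
  -- Before time `T / ε` the curve advances at speed at least `ε * a / 2` in the direction `η x₀`.
  have hder : ∀ t ∈ Icc 0 (T / ε), HasDerivAt (fun s => η x₀ (x s)) (η x₀ (v t)) t := fun t ht =>
    (η x₀).hasFDerivAt.comp_hasDerivAt t (hm t (hsub ht)).hasDerivAt_pos
  have hlow : ∀ t ∈ Icc 0 (T / ε), ε * a / 2 ≤ η x₀ (v t) := by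
    intro t ht
    have h1 := hB.momentum_ge hm hxR t (hsub ht)
    rw [hE0, ← hK_def] at h1
    have h2 : 2 * G (x 0) (v 0) (Y (x 0)) = 2 * ε * a := by
      rw [hx0, hv0]
      simp only [map_smul, smul_apply, smul_eq_mul, ha_def]
      ring
    have h3 : K * (ε ^ 2 * a) * t ≤ ε * a := by
      have h4 : ε * t ≤ T := by
        have := mul_le_mul_of_nonneg_left ht.2 hε.le
        rwa [mul_div_cancel₀ _ hε.ne'] at this
      have h5 : K * T ≤ 1 := by
        rw [hT_def, mul_one_div, div_le_one (by positivity)]; linarith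
      calc K * (ε ^ 2 * a) * t = (K * (ε * t)) * (ε * a) := by ring
        _ ≤ 1 * (ε * a) := by
          gcongr
          exact (mul_le_mul_of_nonneg_left h4 hK).trans h5
        _ = ε * a := one_mul _
    have h6 : 2 * G (x t) (v t) (Y (x t)) = η (x t) (v t) := by
      rw [hB.symm _ (hxR t (hsub ht))]
      rfl
    have h7 : (η (x t) - η x₀) (v t) ≤ ε * a / 2 := by
      have h8 : ‖η (x t) - η x₀‖ ≤ a / (2 * κ) := by
        rw [← dist_eq_norm]
        exact hδη (closedBall_subset_closedBall hrδ (hxr t (hsub ht)))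
      refine (le_abs_self _).trans (((η (x t) - η x₀).le_opNorm _).trans ?_)
      calc _ ≤ a / (2 * κ) * (κ * ε) := by
            gcongr
            exact hspeed t (hsub ht)
        _ = ε * a / 2 := by field_simp
    rw [sub_apply] at h7
    linarith
  have hadv : ε * a / 2 * (T / ε - 0) ≤ η x₀ (x (T / ε)) - η x₀ (x 0) := by
    refine Convex.mul_sub_le_image_sub_of_le_deriv (convex_Icc 0 (T / ε))
      (fun t ht => (hder t ht).continuousAt.continuousWithinAt) (fun t ht => ?_) (fun t ht => ?_)
      0 (left_mem_Icc.2 hT0) _ (right_mem_Icc.2 hT0) hT0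
    · exact (hder t (interior_subset ht)).differentiableAt.differentiableWithinAt
    · rw [(hder t (interior_subset ht)).deriv]
      exact hlow t (interior_subset ht)
  have hfar : η x₀ (x (T / ε)) - η x₀ (x 0) ≤ ‖η x₀‖ * r := by
    rw [← map_sub, hx0]
    refine (le_abs_self _).trans (((η x₀).le_opNorm _).trans ?_)
    gcongr
    exact mem_closedBall_iff_norm.1 (hxr _ (hsub (right_mem_Icc.2 hT0)))
  have hnear : ‖η x₀‖ * r ≤ a * T / 4 := by
    calc ‖η x₀‖ * r ≤ (‖η x₀‖ + 1) * (a * T / (4 * (‖η x₀‖ + 1))) := by gcongr; linarith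
      _ = a * T / 4 := by field_simp
  have hadv' : ε * a / 2 * (T / ε - 0) = a * T / 2 := by field_simp; ring
  have : 0 < a * T := by positivity
  linarith

end IsLogarithmicSystem

/-! ### Existence of the escaping motions -/

theorem contDiffOn_two_of_hasDerivAt {x v a : ℝ → E} {J : Set ℝ} (hJ : IsOpen J)
    (hx : ∀ t ∈ J, HasDerivAt x (v t) t) (hv : ∀ t ∈ J, HasDerivAt v (a t) t)
    (ha : ContinuousOn a J) : ContDiffOn ℝ 2 x J := by
  have h1 : ContDiffOn ℝ 1 v J := by
    rw [show (1 : ℕ∞ω) = 0 + 1 from rfl, contDiffOn_succ_iff_deriv_of_isOpen hJ]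
    exact ⟨fun t ht => (hv t ht).differentiableAt.differentiableWithinAt, by simp,
      contDiffOn_zero.2 (ha.congr fun t ht => (hv t ht).deriv)⟩
  rw [show (2 : ℕ∞ω) = 1 + 1 from (one_add_one_eq_two).symm,
    contDiffOn_succ_iff_deriv_of_isOpen hJ]
  exact ⟨fun t ht => (hx t ht).differentiableAt.differentiableWithinAt, by simp,
    h1.congr fun t ht => (hx t ht).deriv⟩

namespace IsLogarithmicSystem

variable {G : E → E →L[ℝ] E →L[ℝ] ℝ} {u : E → ℝ} {Y : E → E} {P : E → ℝ} {O : Set E} {x₀ : E}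

/-- Instability in coordinates: arbitrarily slow motions starting at `x₀` leave a fixed ball. -/
theorem exists_motion_leaving_ball [FiniteDimensional ℝ E] (h : IsLogarithmicSystem G u Y P O x₀) :
    ∃ r > 0, ∃ ε₀ > 0, ∀ ε ∈ Ioo (0 : ℝ) ε₀, ∃ (x v : ℝ → E) (J : Set ℝ),
      IsOpen J ∧ J.OrdConnected ∧
      0 ∈ J ∧ x 0 = x₀ ∧ v 0 = ε • Y x₀ ∧ ContDiffOn ℝ 2 x J ∧
      (∀ t ∈ J, x t ∈ O ∧ IsMechanicalAt G u x v t) ∧ ∃ t ∈ J, 0 ≤ t ∧ x t ∉ ball x₀ r := by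
  obtain ⟨R, r, κ, T, hr, hrR, hT, hRO, hesc⟩ := h.exists_escape_time
  have hR : 0 < R := hr.trans hrR
  obtain ⟨a, ha, hacc⟩ := exists_acceleration h.isOpen h.contDiffOn_metric
    h.contDiffOn_potential h.pos
  have hRO' : closedBall ((x₀, 0) : E × E) (2 * R) ⊆ O ×ˢ univ := by
    rw [← closedBall_prod_same]
    exact prod_mono hRO (subset_univ _)
  obtain ⟨F, hF, hFc, hFeq⟩ := exists_contDiff_hasCompactSupport_eqOn_closedBall
    (F := fun z : E × E => (z.2, a z)) (h.isOpen.prod isOpen_univ) (contDiffOn_snd.prodMk ha)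
    hR hRO'
  have hY : 0 < ‖Y x₀‖ := norm_pos_iff.2 h.field_ne_zero
  refine ⟨r, hr, min (R / ‖Y x₀‖) (R / (|κ| + 1)), by positivity, ?_⟩
  rintro ε ⟨hε, hε₀⟩
  have hε₁ : ε * ‖Y x₀‖ < R := (lt_div_iff₀ hY).1 (hε₀.trans_le (min_le_left _ _))
  have hε₂ : κ * ε < R := by
    have h1 := (lt_div_iff₀ (by positivity)).1 (hε₀.trans_le (min_le_right _ _))
    nlinarith [le_abs_self κ]
  have hT₁ : 0 < 2 * (T / ε) + 1 := by positivity
  obtain ⟨z, hz0, hz⟩ := exists_hasDerivAt_of_hasCompactSupport hF hFc hT₁ (x₀, ε • Y x₀)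
  have hzc : ∀ t ∈ Ioo (-(2 * (T / ε) + 1)) (2 * (T / ε) + 1), ContinuousAt z t := fun t ht =>
    (hz t ht).continuousAt
  have hz0B : z 0 ∈ ball ((x₀, 0) : E × E) R := by
    rw [hz0, ← ball_prod_same]
    refine ⟨mem_ball_self hR, ?_⟩
    rwa [mem_ball_zero_iff, norm_smul, Real.norm_of_nonneg hε.le]
  -- Suppose that no motion with these initial data leaves the small ball.
  by_contra! hcon
  -- As long as the cut-off is not felt, `z` is a genuine motion, hence by assumption stays in the
  -- small ball.
  have hstay : ∀ t₁ ∈ Ioc 0 (2 * (T / ε)), (∀ t ∈ Ico 0 t₁, z t ∈ ball ((x₀, 0) : E × E) R) →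
      ∀ t ∈ Ico 0 t₁, (z t).1 ∈ ball x₀ r ∧
        IsMechanicalAt G u (fun s => (z s).1) (fun s => (z s).2) t := by
    intro t₁ ht₁ hball
    obtain ⟨η, hη, hηB⟩ := Metric.mem_nhds_iff.1
      ((hzc 0 ⟨by linarith, hT₁⟩).preimage_mem_nhds (isOpen_ball.mem_nhds hz0B))
    set η' := min η 1 with hη'
    have hη'0 : 0 < η' := by positivity
    have hJball : ∀ t ∈ Ioo (-η') t₁, z t ∈ ball ((x₀, 0) : E × E) R := by
      intro t ht
      rcases le_or_gt 0 t with h0 | h0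
      · exact hball t ⟨h0, ht.2⟩
      · refine hηB ?_
        rw [Real.ball_eq_Ioo]
        have := min_le_left η 1
        exact ⟨by linarith [ht.1], by linarith⟩
    have hTε : 0 < T / ε := by positivity
    have hJsub : ∀ t ∈ Ioo (-η') t₁, t ∈ Ioo (-(2 * (T / ε) + 1)) (2 * (T / ε) + 1) := by
      intro t ht
      have := min_le_right η 1
      exact ⟨by linarith [ht.1], by linarith [ht.2, ht₁.2]⟩
    have hder : ∀ t ∈ Ioo (-η') t₁, HasDerivAt z ((z t).2, a (z t)) t := by
      intro t ht
      have h1 := hz t (hJsub t ht)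
      rwa [hFeq (ball_subset_closedBall (hJball t ht))] at h1
    have hO : ∀ t ∈ Ioo (-η') t₁, (z t).1 ∈ O := fun t ht =>
      (hRO' (ball_subset_closedBall.trans (closedBall_subset_closedBall (by linarith))
        (hJball t ht))).1
    have hmech : ∀ t ∈ Ioo (-η') t₁,
        IsMechanicalAt G u (fun s => (z s).1) (fun s => (z s).2) t := fun t ht =>
      ⟨(hder t ht).fst, a (z t), (hder t ht).snd, hacc _ (hO t ht) _⟩
    have hC2 : ContDiffOn ℝ 2 (fun s => (z s).1) (Ioo (-η') t₁) := by
      refine contDiffOn_two_of_hasDerivAt (v := fun s => (z s).2) (a := fun s => a (z s)) isOpen_Ioo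
        (fun t ht => (hder t ht).fst) (fun t ht => (hder t ht).snd) ?_
      exact ha.continuousOn.comp (fun t ht => (hder t ht).continuousAt.continuousWithinAt)
        fun t ht => ⟨hO t ht, mem_univ _⟩
    have := hcon _ _ (Ioo (-η') t₁) isOpen_Ioo ordConnected_Ioo ⟨by linarith, ht₁.1⟩
      (by simp [hz0]) (by simp [hz0]) hC2 (fun t ht => ⟨hO t ht, hmech t ht⟩)
    intro t ht
    have htJ : t ∈ Ioo (-η') t₁ := ⟨by linarith [ht.1], ht.2⟩
    exact ⟨this t htJ ht.1, hmech t htJ⟩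
  -- The estimates on the motion then prevent it from ever feeling the cut-off.
  have hTε : 0 < T / ε := by positivity
  have hball : ∀ t ∈ Icc 0 (2 * (T / ε)), z t ∈ ball ((x₀, 0) : E × E) R := by
    by_contra! hbad
    have hclosed : IsCompact (Icc 0 (2 * (T / ε)) ∩ z ⁻¹' (ball ((x₀, 0) : E × E) R)ᶜ) := by
      refine isCompact_Icc.of_isClosed_subset ?_ inter_subset_left
      refine ContinuousOn.preimage_isClosed_of_isClosed (fun t ht => ?_) isClosed_Icc
        isOpen_ball.isClosed_compl
      exact (hzc t ⟨by linarith [ht.1], by linarith [ht.2]⟩).continuousWithinAt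
    obtain ⟨t₁, ⟨ht₁, ht₁B⟩, hmin⟩ := hclosed.exists_isLeast
      (by obtain ⟨t, ht, htB⟩ := hbad; exact ⟨t, ht, htB⟩)
    have ht₁0 : 0 < t₁ := by
      refine lt_of_le_of_ne ht₁.1 fun h0 => ht₁B ?_
      rw [← h0]; exact hz0B
    have hst := hstay t₁ ⟨ht₁0, ht₁.2⟩ fun t ht => by
      by_contra hn
      exact absurd (hmin ⟨⟨ht.1, ht.2.le.trans ht₁.2⟩, hn⟩) (not_le.2 ht.2)
    have hK : ∀ t ∈ Ico 0 t₁, z t ∈ closedBall x₀ r ×ˢ closedBall (0 : E) (κ * ε) := by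
      intro t ht
      refine ⟨ball_subset_closedBall (hst t ht).1, mem_closedBall_zero_iff.2 ?_⟩
      exact (hesc ε hε t ht.1 _ _ (by simp [hz0]) (by simp [hz0])
        (fun s hs => (hst s ⟨hs.1, hs.2.trans_lt ht.2⟩).2)
        (fun s hs => ball_subset_closedBall (hst s ⟨hs.1, hs.2.trans_lt ht.2⟩).1)).1 t
        (right_mem_Icc.2 ht.1)
    have hlim : z t₁ ∈ closedBall x₀ r ×ˢ closedBall (0 : E) (κ * ε) := by
      refine (isClosed_closedBall.prod isClosed_closedBall).mem_of_tendsto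
        (b := 𝓝[<] t₁) ((hzc t₁ ⟨by linarith, by linarith [ht₁.2]⟩).tendsto.mono_left
          nhdsWithin_le_nhds) ?_
      filter_upwards [Ioo_mem_nhdsLT ht₁0] with t ht
      exact hK t ⟨ht.1.le, ht.2⟩
    apply ht₁B
    rw [← ball_prod_same]
    exact ⟨closedBall_subset_ball hrR hlim.1, closedBall_subset_ball hε₂ hlim.2⟩
  have hst := hstay (2 * (T / ε)) ⟨by positivity, le_rfl⟩ fun t ht =>
    hball t (Ico_subset_Icc_self ht)
  exact lt_irrefl _ (hesc ε hε (T / ε) hTε.le _ _ (by simp [hz0]) (by simp [hz0])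
    (fun s hs => (hst s ⟨hs.1, by linarith [hs.2]⟩).2)
    (fun s hs => ball_subset_closedBall (hst s ⟨hs.1, by linarith [hs.2]⟩).1)).2

end IsLogarithmicSystem

/-! ### Invariance of the Euler-Lagrange equations under changes of coordinates -/

/-- The Euler-Lagrange equations are invariant under a change of coordinates `ψ`. If
`L₁(q, w) = L₀(ψ q, Dψ(q) w)`, the momenta satisfy `p₁ = p₀ ∘ Dψ`; the derivative of this
relation and that of `L₁` in `q` produce second derivatives of `ψ` which agree by symmetry. -/
theorem hasDerivAt_momentum_of_change {L₀ L₁ : E → E → ℝ} {ψ : E → E} {y w : ℝ → E} {t : ℝ}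
    (hψ : ContDiffAt ℝ 2 ψ (y t))
    (hL : ∀ᶠ q in 𝓝 (y t), ∀ w, L₁ q w = L₀ (ψ q) (fderiv ℝ ψ q w))
    (hL₀ : ∀ᶠ x in 𝓝 (ψ (y t)), ∀ v, DifferentiableAt ℝ (fun z : E × E => L₀ z.1 z.2) (x, v))
    (hy : HasDerivAt y (w t) t)
    (hEL : HasDerivAt (fun s => fderiv ℝ (fun v => L₀ (ψ (y s)) v) (fderiv ℝ ψ (y s) (w s)))
      (fderiv ℝ (fun x => L₀ x (fderiv ℝ ψ (y t) (w t))) (ψ (y t))) t) :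
    HasDerivAt (fun s => fderiv ℝ (fun v => L₁ (y s) v) (w s))
      (fderiv ℝ (fun q => L₁ q (w t)) (y t)) t := by
  have hψ' : ContDiffAt ℝ 1 (fderiv ℝ ψ) (y t) := hψ.fderiv_right (by norm_num)
  have hψd : DifferentiableAt ℝ ψ (y t) := hψ.differentiableAt (by norm_num)
  have hψ'd : DifferentiableAt ℝ (fderiv ℝ ψ) (y t) := hψ'.differentiableAt (by norm_num)
  have hsymm : IsSymmSndFDerivAt ℝ ψ (y t) := hψ.isSymmSndFDerivAt (by simp)
  have hp : ∀ᶠ q in 𝓝 (y t), ∀ w, fderiv ℝ (fun v => L₁ q v) w =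
      (fderiv ℝ (fun v => L₀ (ψ q) v) (fderiv ℝ ψ q w)).comp (fderiv ℝ ψ q) := by
    filter_upwards [hL, hψd.continuousAt.eventually hL₀] with q hq hq₀ w
    rw [show (fun v => L₁ q v) = fun v => L₀ (ψ q) (fderiv ℝ ψ q v) from funext hq]
    have h1 : DifferentiableAt ℝ (fun v => L₀ (ψ q) v) (fderiv ℝ ψ q w) :=
      (hq₀ (fderiv ℝ ψ q w)).comp (fderiv ℝ ψ q w)
        (f := fun v => (ψ q, v)) (by fun_prop)
    exact (h1.hasFDerivAt.comp w (fderiv ℝ ψ q).hasFDerivAt).fderiv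
  have hleft := hEL.clm_comp (hψ'd.hasFDerivAt.comp_hasDerivAt t hy)
  refine (hleft.congr_of_eventuallyEq ?_).congr_deriv ?_
  · filter_upwards [hy.continuousAt.eventually hp] with s hs
    exact hs (w s)
  · set v := fderiv ℝ ψ (y t) (w t)
    have hD := (hL₀.self_of_nhds v).hasFDerivAt
    set D := fderiv ℝ (fun z : E × E => L₀ z.1 z.2) (ψ (y t), v) with hDdef
    have hDx : fderiv ℝ (fun x => L₀ x v) (ψ (y t)) = D.comp (.inl ℝ E E) :=
      (HasFDerivAt.comp (ψ (y t)) (f := fun x => (x, v)) hD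
        (hasFDerivAt_prodMk_left (ψ (y t)) v)).fderiv
    have hDv : fderiv ℝ (fun v => L₀ (ψ (y t)) v) v = D.comp (.inr ℝ E E) :=
      (HasFDerivAt.comp v (f := fun v => (ψ (y t), v)) hD
        (hasFDerivAt_prodMk_right (ψ (y t)) v)).fderiv
    have hright : HasFDerivAt (fun q => L₁ q (w t))
        (D.comp ((fderiv ℝ ψ (y t)).prod
          ((fderiv ℝ (fderiv ℝ ψ) (y t)).flip (w t)))) (y t) := by
      have h1 : HasFDerivAt (fun q => (ψ q, fderiv ℝ ψ q (w t)))
          ((fderiv ℝ ψ (y t)).prod ((fderiv ℝ (fderiv ℝ ψ) (y t)).flip (w t))) (y t) := by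
        refine hψd.hasFDerivAt.prodMk ?_
        convert hψ'd.hasFDerivAt.clm_apply (hasFDerivAt_const (w t) (y t)) using 1
        ext; simp
      refine (HasFDerivAt.comp (y t) (f := fun q => (ψ q, fderiv ℝ ψ q (w t)))
        hD h1).congr_of_eventuallyEq ?_
      filter_upwards [hL] with q hq
      exact hq (w t)
    rw [hright.fderiv]
    ext k
    simp only [Function.comp, hDx, hDv, add_apply, ContinuousLinearMap.comp_apply,
      ContinuousLinearMap.inl_apply, ContinuousLinearMap.inr_apply, ContinuousLinearMap.prod_apply,
      ContinuousLinearMap.flip_apply]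
    rw [← map_add, hsymm.eq (w t) k]
    simp

end Coordinates

/-! ### Mechanical systems on manifolds, read in charts -/

section Charts

variable {n : ℕ} {M : Type*} [TopologicalSpace M] [ChartedSpace (EuclideanSpace ℝ (Fin n)) M]

local notation "𝔼" n => EuclideanSpace ℝ (Fin n)

theorem two_le_infty : (2 : ℕ∞ω) ≤ ∞ := by
  exact WithTop.coe_le_coe.2 (le_top : (2 : ℕ∞) ≤ ⊤)

theorem mdifferentiableAt_chart {e : OpenPartialHomeomorph M (𝔼 n)}
    (he : e ∈ IsManifold.maximalAtlas (𝓡 n) ∞ M) {x : M} (hx : x ∈ e.source) :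
    MDifferentiableAt (𝓡 n) (𝓡 n) e x :=
  (contMDiffAt_of_mem_maximalAtlas he hx).mdifferentiableAt (by simp)

theorem mdifferentiableAt_chart_symm {e : OpenPartialHomeomorph M (𝔼 n)}
    (he : e ∈ IsManifold.maximalAtlas (𝓡 n) ∞ M) {y : 𝔼 n} (hy : y ∈ e.target) :
    MDifferentiableAt (𝓡 n) (𝓡 n) e.symm y :=
  (contMDiffAt_symm_of_mem_maximalAtlas he hy).mdifferentiableAt (by simp)

theorem mdifferentiable_chart {e : OpenPartialHomeomorph M (𝔼 n)}
    (he : e ∈ IsManifold.maximalAtlas (𝓡 n) ∞ M) : e.MDifferentiable (𝓡 n) (𝓡 n) :=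
  ⟨fun _ hx => (mdifferentiableAt_chart he hx).mdifferentiableWithinAt,
    fun _ hy => (mdifferentiableAt_chart_symm he hy).mdifferentiableWithinAt⟩

/-- The identification of `ℝⁿ × ℝⁿ` with the tangent bundle of `ℝⁿ` is smooth. -/
theorem contMDiff_totalSpaceMk_modelSpace :
    ContMDiff 𝓘(ℝ, (𝔼 n) × (𝔼 n)) (𝓡 n).tangent ∞
      (fun z : (𝔼 n) × (𝔼 n) => (⟨z.1, z.2⟩ : TangentBundle (𝓡 n) (𝔼 n))) := by
  have h1 : ContMDiff 𝓘(ℝ, (𝔼 n) × (𝔼 n)) (𝓡 n).tangent ∞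
      (fun z : (𝔼 n) × (𝔼 n) => (show ModelProd (𝔼 n) (𝔼 n) from z)) :=
    contMDiff_iff.2 ⟨continuous_id, fun _ _ => contDiffOn_id⟩
  have h2 := contMDiff_tangentBundleModelSpaceHomeomorph_symm (I := 𝓡 n) (n := ∞)
  rw [tangentBundleModelSpaceHomeomorph_coe_symm] at h2
  exact h2.comp h1

/-- The tangent map of an inverse chart is smooth, as a map from `ℝⁿ × ℝⁿ`. -/
theorem contMDiffOn_tangentMap_chart_symm [IsManifold (𝓡 n) ∞ M]
    {e : OpenPartialHomeomorph M (𝔼 n)}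
    (he : e ∈ IsManifold.maximalAtlas (𝓡 n) ∞ M) :
    ContMDiffOn 𝓘(ℝ, (𝔼 n) × (𝔼 n)) (𝓡 n).tangent ∞
      (fun z : (𝔼 n) × (𝔼 n) =>
        (tangentMap (𝓡 n) (𝓡 n) e.symm ⟨z.1, z.2⟩ : TangentBundle (𝓡 n) M))
      (e.target ×ˢ univ) := by
  have h1 : ContMDiffOn (𝓡 n).tangent (𝓡 n).tangent ∞
      (tangentMapWithin (𝓡 n) (𝓡 n) e.symm e.target) (Bundle.TotalSpace.proj ⁻¹' e.target) :=
    (contMDiffOn_symm_of_mem_maximalAtlas he).contMDiffOn_tangentMapWithin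
      (m := ∞) (by simp) e.open_target.uniqueMDiffOn
  have h2 : ContMDiffOn 𝓘(ℝ, (𝔼 n) × (𝔼 n)) (𝓡 n).tangent ∞
      (fun z : (𝔼 n) × (𝔼 n) =>
        (tangentMapWithin (𝓡 n) (𝓡 n) e.symm e.target ⟨z.1, z.2⟩ : TangentBundle (𝓡 n) M))
      (e.target ×ˢ univ) :=
    h1.comp (contMDiff_totalSpaceMk_modelSpace (n := n)).contMDiffOn (s := e.target ×ˢ univ)
      fun z hz => hz.1
  refine h2.congr fun z hz => ?_
  exact (tangentMapWithin_eq_tangentMap (p := (⟨z.1, z.2⟩ : TangentBundle (𝓡 n) (𝔼 n)))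
    (e.open_target.uniqueMDiffOn z.1 hz.1) (mdifferentiableAt_chart_symm he hz.1)).symm

/-- The symmetric bilinear forms associated with a smooth family of quadratic forms depend smoothly
on the parameter. -/
theorem exists_contDiffOn_bilinear_of_quadratic {E : Type*} [NormedAddCommGroup E]
    [NormedSpace ℝ E] [FiniteDimensional ℝ E] {O : Set E} (q : E → QuadraticForm ℝ E)
    {m : ℕ∞ω} (hq : ∀ v, ContDiffOn ℝ m (fun x => q x v) O) :
    ∃ G : E → E →L[ℝ] E →L[ℝ] ℝ, ContDiffOn ℝ m G O ∧ (∀ x v w, G x v w = G x w v) ∧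
      ∀ x v, G x v v = q x v := by
  refine ⟨fun x => (QuadraticMap.associated (q x)).toContinuousBilinearMap, ?_, ?_, ?_⟩
  · rw [contDiffOn_clm_apply]
    intro v
    rw [contDiffOn_clm_apply]
    intro w
    simp only [LinearMap.toContinuousBilinearMap_apply, QuadraticMap.associated_apply]
    exact (((hq (v + w)).sub (hq v)).sub (hq w)).const_smul (⅟2 : ℝ)
  · intro x v w
    simp only [LinearMap.toContinuousBilinearMap_apply, QuadraticMap.associated_apply, add_comm v w]
    congr 1
    ring
  · intro x v
    simp only [LinearMap.toContinuousBilinearMap_apply]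
    exact QuadraticMap.associated_eq_self_apply ℝ (q x) v

/-- In a chart, a mechanical Lagrangian is `G_x(v, v) - U(x)` for a smooth Riemannian metric `G`. -/
theorem KineticTerm.exists_metric_inChart [IsManifold (𝓡 n) ∞ M] (Q : KineticTerm n M) (U : M → ℝ)
    {e : OpenPartialHomeomorph M (𝔼 n)} (he : e ∈ IsManifold.maximalAtlas (𝓡 n) ∞ M) :
    ∃ G : (𝔼 n) → (𝔼 n) →L[ℝ] (𝔼 n) →L[ℝ] ℝ, ContDiffOn ℝ 2 G e.target ∧
      (∀ x v w, G x v w = G x w v) ∧ (∀ x ∈ e.target, ∀ v, v ≠ 0 → 0 < G x v v) ∧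
      ∀ x v, lagrangianInChart (Q.lagrangian U) e x v = G x v v - U (e.symm x) := by
  let q : (𝔼 n) → QuadraticForm ℝ (𝔼 n) := fun x =>
    (Q.form (e.symm x)).comp (mfderiv (𝓡 n) (𝓡 n) e.symm x : (𝔼 n) →L[ℝ] (𝔼 n)).toLinearMap
  have hq : ∀ v, ContDiffOn ℝ 2 (fun x => q x v) e.target := by
    intro v
    have h1 := (Q.smooth.comp_contMDiffOn (contMDiffOn_tangentMap_chart_symm he)).contDiffOn
    have h2 : ContDiffOn ℝ ∞ (fun x : 𝔼 n => (x, v)) e.target := by fun_prop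
    exact (h1.comp h2 fun x hx => ⟨hx, mem_univ _⟩).of_le two_le_infty
  obtain ⟨G, hG, hsymm, hGq⟩ := exists_contDiffOn_bilinear_of_quadratic q hq
  refine ⟨G, hG, hsymm, fun x hx v hv => ?_, fun x v => ?_⟩
  · rw [hGq]
    refine Q.posDef (e.symm x) _ fun h0 => hv ?_
    have hinj := (mdifferentiable_chart he).symm.ker_mfderiv_eq_bot hx
    exact LinearMap.ker_eq_bot'.1 hinj v h0
  · rw [hGq]
    rfl

/-- The transformation law of a Lagrangian under the change of charts `e ∘ e'.symm`. -/
theorem lagrangianInChart_change (L : TangentBundle (𝓡 n) M → ℝ)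
    {e e' : OpenPartialHomeomorph M (𝔼 n)} (he : e ∈ IsManifold.maximalAtlas (𝓡 n) ∞ M)
    (he' : e' ∈ IsManifold.maximalAtlas (𝓡 n) ∞ M) {y : 𝔼 n} (hy : y ∈ e'.target)
    (hye : e'.symm y ∈ e.source) (w : 𝔼 n) :
    lagrangianInChart L e' y w =
      lagrangianInChart L e (e (e'.symm y)) (fderiv ℝ (e ∘ e'.symm) y w) := by
  have hd' := mdifferentiableAt_chart_symm he' hy
  have hψ : MDifferentiableAt (𝓡 n) (𝓡 n) (e ∘ e'.symm) y :=
    (mdifferentiableAt_chart he hye).comp y hd'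
  have heq : e.symm ∘ (e ∘ e'.symm) =ᶠ[𝓝 y] e'.symm := by
    filter_upwards [(e'.continuousAt_symm hy).preimage_mem_nhds (e.open_source.mem_nhds hye)]
      with z hz
    exact e.left_inv hz
  have h1 : tangentMap (𝓡 n) (𝓡 n) e'.symm ⟨y, w⟩
      = tangentMap (𝓡 n) (𝓡 n) (e.symm ∘ (e ∘ e'.symm)) ⟨y, w⟩ := by
    have key : ∀ (a b : M) (X X' : 𝔼 n), a = b → X = X' →
        (⟨a, X⟩ : TangentBundle (𝓡 n) M) = ⟨b, X'⟩ := by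
      rintro a _ X _ rfl rfl; rfl
    refine key _ _ _ _ heq.eq_of_nhds.symm ?_
    exact congrArg (fun A : (𝔼 n) →L[ℝ] (𝔼 n) => A w) heq.mfderiv_eq.symm
  have h2 : tangentMap (𝓡 n) (𝓡 n) (e.symm ∘ (e ∘ e'.symm)) ⟨y, w⟩
      = tangentMap (𝓡 n) (𝓡 n) e.symm (tangentMap (𝓡 n) (𝓡 n) (e ∘ e'.symm) ⟨y, w⟩) :=
    tangentMap_comp_at (I := 𝓡 n) (I' := 𝓡 n) (I'' := 𝓡 n)
      (⟨y, w⟩ : TangentBundle (𝓡 n) (𝔼 n))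
      (mdifferentiableAt_chart_symm he (e.map_source hye)) hψ
  have h3 : tangentMap (𝓡 n) (𝓡 n) (e ∘ e'.symm) ⟨y, w⟩
      = ⟨e (e'.symm y), fderiv ℝ (e ∘ e'.symm) y w⟩ := by
    simp only [tangentMap, mfderiv_eq_fderiv]
    rfl
  exact congrArg L (h1.trans (h2.trans (congrArg _ h3)))

/-- A curve which satisfies the equations of motion in one chart satisfies the Euler-Lagrange
equations in every chart. -/
theorem eulerLagrangeAt_of_isMechanicalAt {L : TangentBundle (𝓡 n) M → ℝ}
    {e e' : OpenPartialHomeomorph M (𝔼 n)} (he : e ∈ IsManifold.maximalAtlas (𝓡 n) ∞ M)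
    (he' : e' ∈ IsManifold.maximalAtlas (𝓡 n) ∞ M)
    {G : (𝔼 n) → (𝔼 n) →L[ℝ] (𝔼 n) →L[ℝ] ℝ} {u : (𝔼 n) → ℝ}
    (hG : ∀ x ∈ e.target, DifferentiableAt ℝ G x) (hu : ∀ x ∈ e.target, DifferentiableAt ℝ u x)
    (hsymm : ∀ x v w, G x v w = G x w v)
    (hL : ∀ x v, lagrangianInChart L e x v = G x v v - u x) {x v : ℝ → 𝔼 n} {J : Set ℝ}
    (hJ : IsOpen J) (hx : ∀ t ∈ J, x t ∈ e.target) (hm : ∀ t ∈ J, IsMechanicalAt G u x v t)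
    {t : ℝ} (ht : t ∈ J) (hte : e.symm (x t) ∈ e'.source) :
    EulerLagrangeAt L e' (e.symm ∘ x) t := by
  set y : ℝ → 𝔼 n := e' ∘ (e.symm ∘ x) with hy
  set ψ : (𝔼 n) → 𝔼 n := e ∘ e'.symm with hψ
  set φ : (𝔼 n) → 𝔼 n := e' ∘ e.symm with hφ
  have hyt : y t ∈ e'.target := e'.map_source hte
  have hback : e'.symm (y t) = e.symm (x t) := e'.left_inv hte
  have hyte : e'.symm (y t) ∈ e.source := by rw [hback]; exact e.map_target (hx t ht)
  have hψt : ψ (y t) = x t := by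
    simp only [hψ, Function.comp, hback]
    exact e.right_inv (hx t ht)
  have hψC : ContDiffAt ℝ 2 ψ (y t) := by
    have h1 : ContMDiffAt (𝓡 n) (𝓡 n) ∞ ψ (y t) :=
      (contMDiffAt_of_mem_maximalAtlas he hyte).comp (y t)
        (contMDiffAt_symm_of_mem_maximalAtlas he' hyt)
    exact h1.contDiffAt.of_le two_le_infty
  have hφd : ∀ s ∈ J, e.symm (x s) ∈ e'.source → DifferentiableAt ℝ φ (x s) := fun s hs hse =>
    ((mdifferentiableAt_chart he' hse).comp (x s)
      (mdifferentiableAt_chart_symm he (hx s hs))).differentiableAt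
  have hev : ∀ᶠ s in 𝓝 t, s ∈ J ∧ e.symm (x s) ∈ e'.source := by
    filter_upwards [hJ.mem_nhds ht, ((e.continuousAt_symm (hx t ht)).comp
      (hm t ht).hasDerivAt_pos.continuousAt).preimage_mem_nhds (e'.open_source.mem_nhds hte)]
      with s h1 h2 using ⟨h1, h2⟩
  have hyd : ∀ᶠ s in 𝓝 t, HasDerivAt y (deriv y s) s := by
    filter_upwards [hev] with s hs
    exact ((hφd s hs.1 hs.2).comp s
      (hm s hs.1).hasDerivAt_pos.differentiableAt).hasDerivAt
  -- Near `t`, the curve and its velocity in the chart `e` are `x` and `v`.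
  have hxy : ∀ᶠ s in 𝓝 t, ψ (y s) = x s := by
    filter_upwards [hev] with s hs
    change e (e'.symm (e' (e.symm (x s)))) = x s
    rw [e'.left_inv hs.2, e.right_inv (hx s hs.1)]
  have hyc : ContinuousAt y t := hyd.self_of_nhds.continuousAt
  have hvel : ∀ᶠ s in 𝓝 t, fderiv ℝ ψ (y s) (deriv y s) = v s := by
    have hψd : ∀ᶠ s in 𝓝 t, DifferentiableAt ℝ ψ (y s) :=
      hyc.eventually ((hψC.eventually (by simp)).mono fun q hq => hq.differentiableAt (by norm_num))
    filter_upwards [hyd, hψd, hxy.eventually_nhds, hev] with s h1 h2 h3 h4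
    have h5 := h2.hasFDerivAt.comp_hasDerivAt s h1
    exact h5.unique ((hm s h4.1).hasDerivAt_pos.congr_of_eventuallyEq h3)
  refine hasDerivAt_momentum_of_change (L₀ := lagrangianInChart L e) (L₁ := lagrangianInChart L e')
    (ψ := ψ) (y := y) (w := deriv y) hψC ?_ ?_ hyd.self_of_nhds ?_
  · filter_upwards [e'.open_target.mem_nhds hyt, (e'.continuousAt_symm hyt).preimage_mem_nhds
      (e.open_source.mem_nhds hyte)] with q h1 h2 w
    exact lagrangianInChart_change L he he' h1 h2 w
  · rw [hψt]
    filter_upwards [e.open_target.mem_nhds (hx t ht)] with q hq w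
    simp only [hL]
    have h1 : DifferentiableAt ℝ (fun z : (𝔼 n) × (𝔼 n) => G z.1) (q, w) :=
      (hG q hq).comp (q, w) (f := Prod.fst) differentiableAt_fst
    have h2 : DifferentiableAt ℝ (fun z : (𝔼 n) × (𝔼 n) => u z.1) (q, w) :=
      (hu q hq).comp (q, w) (f := Prod.fst) differentiableAt_fst
    exact ((h1.clm_apply differentiableAt_snd).clm_apply differentiableAt_snd).sub h2
  · have hmom := (hm t ht).hasDerivAt_momentum (hG _ (hx t ht))
    refine (hmom.congr_of_eventuallyEq ?_).congr_deriv ?_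
    · filter_upwards [hxy, hvel] with s h1 h2
      simp only [h1, h2, hL]
      rw [fderiv_sub_const]
      have h3 : HasFDerivAt (fun v => G (x s) v v) ((2 : ℝ) • G (x s) (v s)) (v s) := by
        refine ((G (x s)).hasFDerivAt.clm_apply (hasFDerivAt_id (v s))).congr_fderiv ?_
        ext k
        simp [hsymm (x s) k (v s), two_mul]
      exact h3.fderiv
    · rw [hxy.self_of_nhds, hvel.self_of_nhds]
      simp only [hL]
      have h4 : HasFDerivAt (fun q => G q (v t) (v t) - u q) (force G u (x t) (v t)) (x t) := by
        have h5 := ((hG _ (hx t ht)).hasFDerivAt.clm_apply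
          (hasFDerivAt_const (v t) (x t))).clm_apply (hasFDerivAt_const (v t) (x t))
        refine (h5.sub (hu _ (hx t ht)).hasFDerivAt).congr_fderiv ?_
        ext k
        simp [force_apply]
      exact h4.fderiv.symm

/-! ### Equilibrium and instability -/

/-- A zero of a nonnegative potential is an equilibrium, being a minimum of the potential. -/
theorem KineticTerm.isEquilibrium_of_isMin [IsManifold (𝓡 n) ∞ M] (Q : KineticTerm n M) {U : M → ℝ}
    (hU : ∀ x, 0 ≤ U x) {p : M} (hp : U p = 0) : IsEquilibrium (Q.lagrangian U) p where
  isOpen := isOpen_univ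
  ordConnected := ordConnected_univ
  contMDiffOn := contMDiffOn_const
  eulerLagrange := by
    intro t _ e _ hpe
    have hder : ∀ s : ℝ, deriv (e ∘ fun _ : ℝ => p) s = 0 := fun s => deriv_const s (e p)
    have hrest : ∀ x, lagrangianInChart (Q.lagrangian U) e x 0 = -U (e.symm x) := by
      intro x
      have h0 : mfderiv (𝓡 n) (𝓡 n) e.symm x (0 : 𝔼 n) = 0 := map_zero _
      simp only [lagrangianInChart, KineticTerm.lagrangian]
      rw [h0, QuadraticMap.map_zero, zero_sub]
    have hmax : IsLocalMax (fun x => lagrangianInChart (Q.lagrangian U) e x 0) (e p) := by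
      refine Filter.Eventually.of_forall fun x => ?_
      simp only [hrest, e.left_inv hpe, hp]
      linarith [hU (e.symm x)]
    unfold EulerLagrangeAt
    simp only [hder, hmax.fderiv_eq_zero]
    exact hasDerivAt_const _ _

/-- A mechanical system with a weakly logarithmic field, read in a chart around `p`. -/
theorem isLogarithmicSystem_inChart {U : M → ℝ} (hU : ContMDiff (𝓡 n) 𝓘(ℝ, ℝ) ∞ U)
    (hU_nonneg : ∀ x, 0 ≤ U x) {p : M} (hp : U p = 0) {A : Set M}
    {V : ∀ x : M, TangentSpace (𝓡 n) x} (hA : IsOpen A) (hpA : p ∈ A)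
    (hV : IsLocallyLipschitzFieldOn V A) {P : M → ℝ}
    (hPb : ∀ K : Set M, K ⊆ A → IsCompact K → Bornology.IsBounded (P '' K))
    (hP : ∀ x ∈ A, (mfderiv (𝓡 n) 𝓘(ℝ, ℝ) U x (V x) : ℝ) = P x * U x) (hVp : V p ≠ 0)
    {e : OpenPartialHomeomorph M (𝔼 n)} (he : e ∈ IsManifold.maximalAtlas (𝓡 n) ∞ M)
    (hpe : p ∈ e.source) {G : (𝔼 n) → (𝔼 n) →L[ℝ] (𝔼 n) →L[ℝ] ℝ}
    (hG : ContDiffOn ℝ 2 G e.target) (hsymm : ∀ x v w, G x v w = G x w v)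
    (hpos : ∀ x ∈ e.target, ∀ v, v ≠ 0 → 0 < G x v v) :
    IsLogarithmicSystem G (U ∘ e.symm)
      (fun y => mfderiv (𝓡 n) (𝓡 n) e (e.symm y) (V (e.symm y))) (P ∘ e.symm)
      (e.target ∩ e.symm ⁻¹' A) (e p) where
  isOpen := e.symm.isOpen_inter_preimage hA
  mem := ⟨e.map_source hpe, by simpa [e.left_inv hpe] using hpA⟩
  contDiffOn_metric := hG.mono inter_subset_left
  contDiffOn_potential := by
    have h1 := hU.comp_contMDiffOn (contMDiffOn_symm_of_mem_maximalAtlas he)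
    exact (h1.contDiffOn.of_le two_le_infty).mono inter_subset_left
  symm := fun x _ => hsymm x
  pos := fun x hx => hpos x hx.1
  nonneg := fun x _ => hU_nonneg _
  potential_eq_zero := by simp [e.left_inv hpe, hp]
  locallyLipschitz := hV e he
  field_ne_zero := by
    have key : ∀ q, q = p → mfderiv (𝓡 n) (𝓡 n) e q (V q) ≠ 0 := by
      rintro q rfl h0
      exact hVp (LinearMap.ker_eq_bot'.1
        ((mdifferentiable_chart he).ker_mfderiv_eq_bot hpe) (V q) h0)
    exact key _ (e.left_inv hpe)
  fderiv_field := by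
    have key : ∀ x ∈ e.source, x ∈ A →
        fderiv ℝ (U ∘ e.symm) (e x) (mfderiv (𝓡 n) (𝓡 n) e x (V x)) = P x * U x := by
      intro x hx hxA
      have hUd : MDifferentiableAt (𝓡 n) 𝓘(ℝ, ℝ) U (e.symm (e x)) :=
        hU.mdifferentiableAt (by simp)
      have h1 := mfderiv_comp (e x) hUd (mdifferentiableAt_chart_symm he (e.map_source hx))
      rw [mfderiv_eq_fderiv] at h1
      have h2 := (mdifferentiable_chart he).symm_comp_deriv hx
      have h3 := congrArg (fun A : TangentSpace (𝓡 n) x →L[ℝ] TangentSpace (𝓡 n) x => A (V x)) h2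
      rw [← hP x hxA]
      have h4 : ∀ z, z = x → ∀ w : 𝔼 n, (mfderiv (𝓡 n) 𝓘(ℝ, ℝ) U z : (𝔼 n) →L[ℝ] ℝ) w
          = (mfderiv (𝓡 n) 𝓘(ℝ, ℝ) U x : (𝔼 n) →L[ℝ] ℝ) w := by
        rintro _ rfl _; rfl
      refine (congrArg (fun B : (𝔼 n) →L[ℝ] ℝ => B (mfderiv (𝓡 n) (𝓡 n) e x (V x))) h1).trans ?_
      refine (h4 _ (e.left_inv hx) _).trans ?_
      exact congrArg (mfderiv (𝓡 n) 𝓘(ℝ, ℝ) U x : (𝔼 n) →L[ℝ] ℝ) h3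
    intro y hy
    have h5 := key (e.symm y) (e.map_target hy.1) hy.2
    rwa [e.right_inv hy.1] at h5
  bounded := by
    intro K hK hKc
    rw [image_comp]
    refine hPb _ ?_ (hKc.image_of_continuousOn
      (e.continuousOn_symm.mono fun y hy => (hK hy).1))
    rintro _ ⟨y, hy, rfl⟩
    exact (hK hy).2

/-- The phase point of a curve given in a chart. -/
theorem phasePoint_chart_symm_comp {e : OpenPartialHomeomorph M (𝔼 n)}
    (he : e ∈ IsManifold.maximalAtlas (𝓡 n) ∞ M) {x : ℝ → 𝔼 n} {v : 𝔼 n} {t : ℝ}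
    (hx : HasDerivAt x v t) (ht : x t ∈ e.target) :
    phasePoint n (e.symm ∘ x) t = tangentMap (𝓡 n) (𝓡 n) e.symm ⟨x t, v⟩ := by
  have h1 : tangentMap 𝓘(ℝ, ℝ) (𝓡 n) (e.symm ∘ x) (⟨t, (1 : ℝ)⟩ : TangentBundle 𝓘(ℝ, ℝ) ℝ) =
      tangentMap (𝓡 n) (𝓡 n) e.symm (tangentMap 𝓘(ℝ, ℝ) (𝓡 n) x ⟨t, (1 : ℝ)⟩) :=
    tangentMap_comp_at (I := 𝓘(ℝ, ℝ)) (I' := 𝓡 n) (I'' := 𝓡 n)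
      (⟨t, (1 : ℝ)⟩ : TangentBundle 𝓘(ℝ, ℝ) ℝ) (mdifferentiableAt_chart_symm he ht)
      hx.differentiableAt.mdifferentiableAt
  have h2 : tangentMap 𝓘(ℝ, ℝ) (𝓡 n) x (⟨t, (1 : ℝ)⟩ : TangentBundle 𝓘(ℝ, ℝ) ℝ)
      = (⟨x t, v⟩ : TangentBundle (𝓡 n) (𝔼 n)) := by
    have h3 : (fderiv ℝ x t) 1 = v := by rw [hx.hasFDerivAt.fderiv]; simp
    rw [← h3]
    simp only [tangentMap, mfderiv_eq_fderiv]
    rfl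
  exact h1.trans (congrArg _ h2)

/-- The zero velocity at `e p` represents the rest point of the phase space at `p`. -/
theorem tangentMap_chart_symm_zero {e : OpenPartialHomeomorph M (𝔼 n)} {p : M}
    (hpe : p ∈ e.source) :
    tangentMap (𝓡 n) (𝓡 n) e.symm ⟨e p, (0 : 𝔼 n)⟩ = restPoint n p := by
  have key : ∀ q : M, q = p → (⟨q, (0 : 𝔼 n)⟩ : TangentBundle (𝓡 n) M) = restPoint n p := by
    rintro _ rfl; rfl
  have h0 : mfderiv (𝓡 n) (𝓡 n) e.symm (e p) (0 : 𝔼 n) = 0 := map_zero _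
  refine Eq.trans ?_ (key _ (e.left_inv hpe))
  simp only [tangentMap]
  rw [h0]
  rfl

end Charts

end Mechanics

open Mechanics Set Metric in
theorem mainTheorem4 {n : ℕ} {M : Type*} [TopologicalSpace M] [T2Space M]
    [ChartedSpace (EuclideanSpace ℝ (Fin n)) M] [IsManifold (𝓡 n) ∞ M]
    (U : M → ℝ) (hU : ContMDiff (𝓡 n) 𝓘(ℝ, ℝ) ∞ U) (hU_nonneg : ∀ x, 0 ≤ U x)
    (p : M) (hp : U p = 0)
    (hV : ∃ (A : Set M) (V : ∀ x : M, TangentSpace (𝓡 n) x),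
      IsOpen A ∧ p ∈ A ∧ Mechanics.IsLocallyLipschitzFieldOn V A ∧
        Mechanics.IsWeaklyLogarithmicOn U V A ∧ V p ≠ 0)
    (Q : Mechanics.KineticTerm n M) :
    Mechanics.IsLyapunovUnstableEquilibrium (Q.lagrangian U) p := by
  refine ⟨Q.isEquilibrium_of_isMin hU_nonneg hp, fun hstable => ?_⟩
  obtain ⟨A, V, hA, hpA, hVL, ⟨P, hPb, hP⟩, hVp⟩ := hV
  set e := chartAt (EuclideanSpace ℝ (Fin n)) p with he_def
  have he : e ∈ IsManifold.maximalAtlas (𝓡 n) ∞ M := IsManifold.chart_mem_maximalAtlas p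
  have hpe : p ∈ e.source := mem_chart_source _ p
  obtain ⟨G, hG, hsymm, hpos, hL⟩ := Q.exists_metric_inChart U he
  have hsys := isLogarithmicSystem_inChart hU hU_nonneg hp hA hpA hVL hPb hP hVp he hpe hG
    hsymm hpos
  obtain ⟨r, hr, ε₀, hε₀, hmotion⟩ := hsys.exists_motion_leaving_ball
  -- Only the positions are constrained by the neighbourhood that the motions will leave.
  have hball : e.source ∩ e ⁻¹' ball (e p) r ∈ 𝓝 p :=
    Filter.inter_mem (e.open_source.mem_nhds hpe)
      ((e.continuousAt hpe).preimage_mem_nhds (ball_mem_nhds _ hr))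
  have hproj : Continuous (Bundle.TotalSpace.proj : TangentBundle (𝓡 n) M → M) :=
    FiberBundle.continuous_proj _ _
  obtain ⟨W', hW', -, hW⟩ := hstable
    (Bundle.TotalSpace.proj ⁻¹' (e.source ∩ e ⁻¹' ball (e p) r))
    (hproj.continuousAt.preimage_mem_nhds hball)
  set Y : EuclideanSpace ℝ (Fin n) → EuclideanSpace ℝ (Fin n) :=
    fun y => mfderiv (𝓡 n) (𝓡 n) e (e.symm y) (V (e.symm y)) with hY
  obtain ⟨ε, hεW', hε⟩ : ∃ ε : ℝ, tangentMap (𝓡 n) (𝓡 n) e.symm ⟨e p, ε • Y (e p)⟩ ∈ W' ∧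
      ε ∈ Ioo 0 ε₀ := by
    have h1 := ((contMDiffOn_tangentMap_chart_symm he).continuousOn).continuousAt
      (x := (e p, 0)) ((e.open_target.prod isOpen_univ).mem_nhds ⟨e.map_source hpe, mem_univ _⟩)
    have h2 : Filter.Tendsto (fun ε : ℝ => (e p, ε • Y (e p))) (𝓝[>] 0) (𝓝 (e p, 0)) := by
      have : Continuous fun ε : ℝ => (e p, ε • Y (e p)) := by fun_prop
      simpa using (this.tendsto 0).mono_left (nhdsWithin_le_nhds (s := Ioi 0))
    have h3 : ∀ᶠ ε in 𝓝[>] (0 : ℝ),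
        tangentMap (𝓡 n) (𝓡 n) e.symm ⟨e p, ε • Y (e p)⟩ ∈ W' :=
      (h1.tendsto.comp h2) (by rwa [← tangentMap_chart_symm_zero hpe] at hW')
    exact (h3.and (Ioo_mem_nhdsGT hε₀)).exists
  obtain ⟨x, v, J, hJ, hJc, h0J, hx0, hv0, hxC, hm, t, htJ, ht0, htr⟩ := hmotion ε hε
  have hxt : ∀ s ∈ J, x s ∈ e.target := fun s hs => (hm s hs).1.1
  have hmot : IsMotionOn (Q.lagrangian U) (e.symm ∘ x) J :=
    { isOpen := hJ
      ordConnected := hJc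
      contMDiffOn := ((contMDiffOn_symm_of_mem_maximalAtlas he).of_le two_le_infty).comp
        hxC.contMDiffOn hxt
      eulerLagrange := fun s hs e' he' hse' =>
        eulerLagrangeAt_of_isMechanicalAt he he'
          (fun y hy => (hG.contDiffAt (e.open_target.mem_nhds hy)).differentiableAt (by norm_num))
          (fun y hy => (hU.mdifferentiableAt (by simp)).comp y
            (mdifferentiableAt_chart_symm he hy) |>.differentiableAt)
          hsymm hL hJ hxt (fun τ hτ => (hm τ hτ).2) hs hse' }
  have hstart : phasePoint n (e.symm ∘ x) 0 ∈ W' := by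
    rw [phasePoint_chart_symm_comp he (hm 0 h0J).2.hasDerivAt_pos (hxt 0 h0J), hx0, hv0]
    exact hεW'
  have hend := (hW _ J hmot h0J hstart t htJ ht0).2
  refine htr ?_
  have : e (e.symm (x t)) ∈ ball (e p) r := hend
  rwa [e.right_inv (hxt t htJ)] at this
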